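/- Let $T\in\mathbb N$ be a horizon. A deterministic forecaster $\mathcal A$ assigns a prediction $p_t=\mathcal A(x_1,\dots,x_{t-1})\in[0,1]$ to each step $t\in[T]$ and each history $(x_1,\dots,x_{t-1})\in\{0,1\}^{t-1}$. A calibration measure $\mathsf{CM}$ is a family of functions $\mathsf{CM}_T:\{0,1\}^T\times[0,1]^T\to[0,T]$, $T\in\mathbb N$. For a probability distribution $\mathcal D$ on $\{0,1\}^T$ put $\mathsf{err}_{\mathsf{CM}}(\mathcal D,\mathcal A)=\mathbb E_{x\sim\mathcal D}[\mathsf{CM}_T(x,p)]$, where $p$ is the sequence of predictions of $\mathcal A$ on $x$, and $\mathsf{OPT}_{\mathsf{CM}}(\mathcal D)=\inf_{\mathcal A}\mathsf{err}_{\mathsf{CM}}(\mathcal D,\mathcal A)$, the infimum being over all deterministic forecasters. The truthful forecaster $\mathcal A^{\mathrm{truthful}}(\mathcal D)$ predicts $\Pr_{x\sim\mathcal D}[x_t=1\mid x_{1:(t-1)}=b_{1:(t-1)}]$ after the history $b_{1:(t-1)}$ (and, say, $0$ if that history has probability zero). Let $\mathcal F$ be the family of $1$-Lipschitz functions from $[0,1]$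 to $[-1,1]$. For outcomes $x$ and predictions $p$ of equal length, the smooth calibration error is $\mathsf{smCE}(x,p)=\sup_{f\in\mathcal F}\sum_t f(p_t)(x_t-p_t)$. The Subsampled Smooth Calibration Error (SSCE) is the calibration measure $$\mathsf{SSCE}(x,p)=\mathbb E_{S}\big[\mathsf{smCE}(x|_S,p|_S)\big],\qquad x\in\{0,1\}^T,\ p\in[0,1]^T,$$ where $S$ is a uniformly random subset of $[T]$ and $x|_S$, $p|_S$ are the restrictions of $x$, $p$ to the indices in $S$. **Theorem.** There is a universal constant $c>0$ such that the SSCE is $(c,0)$-truthful: for every $T$ and every probability distribution $\mathcal D$ on $\{0,1\}^T$, $$\mathsf{err}_{\mathsf{SSCE}}(\mathcal D,\mathcal A^{\mathrm{truthful}}(\mathcal D))\le c\cdot\mathsf{OPT}_{\mathsf{SSCE}}(\mathcal D).$$ Furthermore, the SSCE is complete, that is, 1. $\mathsf{SSCE}(x,x)=0$ for all $T$ and all $x\in\{0,1\}^T$; 2. for every fixed $\alpha\in[0,1]$, $\mathbb E_{x_1,\dots,x_T\sim\mathrm{Bern}(\alpha)}[\mathsf{SSCE}(x,\alpha\cdot\vec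 1_T)]=o(T)$ as $T\to\infty$, where $x_1,\dots,x_T$ are independent; and sound, that is, 1. there is a constant $c_0>0$ such that $\mathsf{SSCE}(x,\vec 1_T-x)\ge c_0T$ for all $T$ and all $x\in\{0,1\}^T$; 2. for all $\alpha,\beta\in[0,1]$ with $\alpha\ne\beta$ there is a constant $c_{\alpha,\beta}>0$ such that $\mathbb E_{x_1,\dots,x_T\sim\mathrm{Bern}(\alpha)}[\mathsf{SSCE}(x,\beta\cdot\vec 1_T)]\ge c_{\alpha,\beta}T$ for all $T$, where $x_1,\dots,x_T$ are independent. -/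

import Mathlib

open scoped unitInterval

noncomputable section

namespace SeqPred

/-- An outcome in `{0,1}`, encoded as a `Bool`, viewed as a point of the unit interval `I = [0,1]`. -/
def bit (b : Bool) : I := if b then 1 else 0

/-- The probability distributions on `{0,1}^T`, as probability vectors indexed by `{0,1}^T`. -/
abbrev Dist (T : ℕ) : Type := stdSimplex ℝ (Fin T → Bool)

/-- The expectation of `g x` over `x ∼ D`. -/
def expect {T : ℕ} (D : Dist T) (g : (Fin T → Bool) → ℝ) : ℝ := ∑ x, D.1 x * g x

/-- The probability of the event `E` under `D`. -/
def prob {T : ℕ} (D : Dist T) (E : Finset (Fin T → Bool)) : ℝ := ∑ x ∈ E, D.1 x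

/-- The sequence of outcomes seen strictly before step `t`. -/
def history {T : ℕ} (x : Fin T → Bool) (t : Fin T) : Fin (t : ℕ) → Bool :=
  fun s => x (Fin.castLE t.isLt.le s)

/-- A deterministic forecaster with horizon `T`: it maps every possible history (at the step with
0-based index `t`, a string of `t` bits) to a prediction in `[0,1]`. -/
abbrev Forecaster (T : ℕ) : Type := (t : Fin T) → (Fin (t : ℕ) → Bool) → I

/-- The predictions made by the forecaster on the outcome sequence `x`. -/
def Forecaster.predict {T : ℕ} (A : Forecaster T) (x : Fin T → Bool) : Fin T → I :=
  fun t => A t (history x t)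

/-- A calibration measure: functions `{0,1}^T × [0,1]^T → [0,T]`, one for every horizon `T`. -/
structure CalibrationMeasure where
  /-- The penalty of the predictions `p` on the outcomes `x`. -/
  penalty : (T : ℕ) → (Fin T → Bool) → (Fin T → I) → ℝ
  penalty_nonneg : ∀ T x p, 0 ≤ penalty T x p
  penalty_le : ∀ T x p, penalty T x p ≤ T

/-- The expected penalty of the forecaster `A` when the outcomes are drawn from `D`. -/
def err (CM : CalibrationMeasure) {T : ℕ} (D : Dist T) (A : Forecaster T) : ℝ :=
  expect D fun x => CM.penalty T x (A.predict x)

/-- The optimal error: the infimum of the expected penalty over all deterministic forecasters. -/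
def OPT (CM : CalibrationMeasure) {T : ℕ} (D : Dist T) : ℝ := ⨅ A : Forecaster T, err CM D A

/-- The truthful forecaster: after the history `b` it predicts the conditional probability, under
`D`, that the next outcome is `1`. (On histories of probability zero, which do not affect any
expectation under `D`, the value is `0`.) -/
def truthful {T : ℕ} (D : Dist T) : Forecaster T := fun t b =>
  ⟨prob D {x | history x t = b ∧ x t = true} / prob D {x | history x t = b}, by
    have h0 : ∀ E : Finset (Fin T → Bool), 0 ≤ prob D E := fun E =>
      Finset.sum_nonneg fun x _ => D.2.1 x
    refine ⟨div_nonneg (h0 _) (h0 _), div_le_one_of_le₀ ?_ (h0 _)⟩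
    refine Finset.sum_le_sum_of_subset_of_nonneg (fun x hx => ?_) fun x _ _ => D.2.1 x
    simp only [Finset.mem_filter] at hx ⊢
    exact ⟨hx.1, hx.2.1⟩⟩

/-- `CM` is `(α, β)`-truthful: for every horizon and every distribution, the truthful forecaster has
expected penalty at most `α * OPT + β`. -/
def IsTruthful (CM : CalibrationMeasure) (α β : ℝ) : Prop :=
  ∀ (T : ℕ) (D : Dist T), err CM D (truthful D) ≤ α * OPT CM D + β

/-- The law of `T` independent Bernoulli variables with parameter `α`. -/
def iidBernoulli (T : ℕ) (α : I) : Dist T :=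
  ⟨fun x => ∏ t, if x t then (α : ℝ) else 1 - α, by
    refine ⟨fun x => Finset.prod_nonneg fun t _ => ?_, ?_⟩
    · split_ifs
      · exact α.2.1
      · exact sub_nonneg.2 α.2.2
    · have h := Finset.prod_univ_sum (fun _ : Fin T => (Finset.univ : Finset Bool))
        (fun _ b => if b then (α : ℝ) else 1 - α)
      rw [Fintype.piFinset_univ] at h
      rw [← h]
      simp⟩

/-- Completeness: perfect predictions have zero penalty, and predicting the true parameter of
i.i.d. Bernoulli outcomes has expected penalty `o(T)`, for each fixed parameter. -/
def IsComplete (CM : CalibrationMeasure) : Prop :=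
  (∀ (T : ℕ) (x : Fin T → Bool), CM.penalty T x (fun t => bit (x t)) = 0) ∧
  ∀ α : I, (fun T : ℕ => expect (iidBernoulli T α) fun x => CM.penalty T x fun _ => α)
    =o[Filter.atTop] fun T : ℕ => (T : ℝ)

/-- Soundness: predicting `1 - x` on the outcomes `x` has penalty `Ω(T)`, uniformly in `x`, and
predicting a wrong parameter `β ≠ α` on i.i.d. Bernoulli outcomes with parameter `α` has expected
penalty `Ω(T)`, with a constant that may depend on `α` and `β`. Here `Ω(T)` means at least a
positive constant times `T`, for every `T`. -/
def IsSound (CM : CalibrationMeasure) : Prop :=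
  (∃ c : ℝ, 0 < c ∧ ∀ (T : ℕ) (x : Fin T → Bool),
    c * T ≤ CM.penalty T x fun t => unitInterval.symm (bit (x t))) ∧
  ∀ α β : I, α ≠ β → ∃ c : ℝ, 0 < c ∧ ∀ T : ℕ,
    c * T ≤ expect (iidBernoulli T α) fun x => CM.penalty T x fun _ => β

/-- The family of `1`-Lipschitz functions from `[0,1]` to `[-1,1]`. -/
def lipFamily : Set (I → ℝ) := {f | LipschitzWith 1 f ∧ ∀ z, f z ∈ Set.Icc (-1 : ℝ) 1}

/-- The smooth calibration error of outcomes and predictions that are indexed by a finite set. -/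
def smCE {ι : Type} [Fintype ι] (x : ι → Bool) (p : ι → I) : ℝ :=
  ⨆ f : lipFamily, ∑ i, f.1 (p i) * ((bit (x i) : ℝ) - p i)

theorem sum_le_card {ι : Type} [Fintype ι] (x : ι → Bool) (p : ι → I) (f : lipFamily) :
    ∑ i, f.1 (p i) * ((bit (x i) : ℝ) - p i) ≤ Fintype.card ι := by
  have h : ∀ i ∈ Finset.univ, f.1 (p i) * ((bit (x i) : ℝ) - p i) ≤ (1 : ℝ) := by
    intro i _
    have h1 : |f.1 (p i)| ≤ 1 := abs_le.2 (f.2.2 (p i))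
    have h2 : |(bit (x i) : ℝ) - p i| ≤ 1 :=
      abs_le.2 ⟨by linarith [(bit (x i)).2.1, (p i).2.2], by linarith [(bit (x i)).2.2, (p i).2.1]⟩
    calc _ ≤ |f.1 (p i) * ((bit (x i) : ℝ) - p i)| := le_abs_self _
      _ = |f.1 (p i)| * |(bit (x i) : ℝ) - p i| := abs_mul _ _
      _ ≤ 1 := mul_le_one₀ h1 (abs_nonneg _) h2
  simpa using Finset.sum_le_card_nsmul _ _ _ h

theorem zero_mem_lipFamily : (fun _ : I => (0 : ℝ)) ∈ lipFamily :=
  ⟨(LipschitzWith.const 0).weaken zero_le_one, fun _ => by simp⟩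

theorem smCE_nonneg {ι : Type} [Fintype ι] (x : ι → Bool) (p : ι → I) : 0 ≤ smCE x p := by
  have hb : BddAbove (Set.range fun f : lipFamily =>
      ∑ i, f.1 (p i) * ((bit (x i) : ℝ) - p i)) :=
    ⟨Fintype.card ι, by rintro _ ⟨f, rfl⟩; exact sum_le_card x p f⟩
  have h := le_ciSup hb ⟨_, zero_mem_lipFamily⟩
  simpa [smCE] using h

theorem smCE_le_card {ι : Type} [Fintype ι] (x : ι → Bool) (p : ι → I) :
    smCE x p ≤ Fintype.card ι := by
  have : Nonempty lipFamily := ⟨⟨_, zero_mem_lipFamily⟩⟩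
  exact ciSup_le (sum_le_card x p)

/-- The Subsampled Smooth Calibration Error: the expected smooth calibration error of the
restrictions of `x` and `p` to a uniformly random subset `S` of the `T` time steps. -/
def SSCE : CalibrationMeasure where
  penalty T x p := (∑ S : Finset (Fin T), smCE (fun i : S => x i) (fun i : S => p i)) / 2 ^ T
  penalty_nonneg T x p := div_nonneg (Finset.sum_nonneg fun _ _ => smCE_nonneg _ _) (by positivity)
  penalty_le T x p := by
    rw [div_le_iff₀ (by positivity)]
    have h : ∀ S ∈ (Finset.univ : Finset (Finset (Fin T))),
        smCE (fun i : S => x i) (fun i : S => p i) ≤ (T : ℝ) := fun S _ =>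
      (smCE_le_card _ _).trans (by
        have := S.card_le_univ
        simp only [Fintype.card_coe, Fintype.card_fin] at this ⊢
        exact_mod_cast this)
    refine (Finset.sum_le_card_nsmul _ _ _ h).trans (le_of_eq ?_)
    simp [mul_comm]

end SeqPred

end

/-!
Truthfulness is proved by comparing both sides with the expectation of `gauge V = V / √(1 + V)`,
where `V` is the sum of the conditional variances `p (1 - p)` along the path, `p` being the
conditional probability of the next outcome.

*The truthful forecaster has error at most `16 * E[gauge V]`* (`expect_penalty_le`). On `[0,1]` a
`1`-Lipschitz function is a constant plus an average, with coefficients in `[-1,1]`, of indicators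
of intervals `[u,1]`, up to a mesh that tends to `0`. Hence the smooth calibration error is at most
the absolute bias plus the average over `u` of the absolute bias on the steps with prediction at
least `u` (`smCE_le_average`), and no chaining argument is needed. Each of these biases is the final
value of a martingale transform `M` with predictable coefficients in `[-1,1]`, and
`E|M| ≤ 8 * E[gauge V]` (`expect_abs_transform_le`): dividing the increments of `M ^ 2`, and the
absolute errors, by the predictable increasing weight `√(1 + V)` gives quantities of expectation
`O(E[gauge V])`, and `|M|` is bounded pathwise by these and `gauge V` (`abs_le_of_abs_le`).

*Every forecaster has error at least a constant times `E[gauge V]`.* Testing with the functions `1`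
and `-1` only, the subsampled error of `p` on `x` is at least the mean of `|∑ i ∈ S, (x i - p i)|`
over random `S`, and hence at least `5 / 18 * √Q` with `Q = ∑ i, (x i - p i) ^ 2`, by Khintchine's
inequality (`sqrt_le_penalty`). Conditionally on the past, the increments of `Q` have mean at least
those of `V`. With the predictable weight `1 / √(1 + V + Q)`, in which `Q` lags by one step, this
yields `E[gauge V] ≤ 9 / 2 * E[√Q]` (`expect_gauge_le_expect_sqrt`).

For independent outcomes the constant forecaster predicts conditional means, so the first bound also
gives an error `O(√T)` and completeness. Soundness follows by testing with `z ↦ 1 / 2 - z`, and with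
constant functions.
-/

namespace SeqPred

open Finset

/-! ### Weighted sums along a path -/

/-- The function `V / √(1 + V)`, within constant factors of `min V √V` for `V ≥ 0`. -/
noncomputable def gauge (V : ℝ) : ℝ := V / √(1 + V)

theorem gauge_nonneg {V : ℝ} (hV : 0 ≤ V) : 0 ≤ gauge V := by
  unfold gauge; positivity

theorem gauge_le_sqrt {V : ℝ} (hV : 0 ≤ V) : gauge V ≤ √V := by
  unfold gauge
  rw [div_le_iff₀ (by positivity)]
  calc V = √V * √V := (Real.mul_self_sqrt hV).symm
    _ ≤ √V * √(1 + V) := by gcongr; linarith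

theorem sqrt_one_add_sub_one_le_gauge {V : ℝ} (hV : 0 ≤ V) : √(1 + V) - 1 ≤ gauge V := by
  unfold gauge
  have h1 : (1 : ℝ) ≤ √(1 + V) := Real.one_le_sqrt.2 (by linarith)
  rw [le_div_iff₀ (by positivity)]
  nlinarith [Real.mul_self_sqrt (show 0 ≤ 1 + V by linarith)]

theorem sub_div_sqrt_le {a b : ℝ} (ha : 0 ≤ a) (hab : a ≤ b) : (b - a) / √b ≤ 2 * (√b - √a) := by
  rcases (ha.trans hab).eq_or_lt with hb | hb
  · have : a = 0 := by linarith
    simp [← hb, this]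
  · rw [div_le_iff₀ (Real.sqrt_pos.2 hb)]
    nlinarith [Real.mul_self_sqrt ha, Real.mul_self_sqrt hb.le, sq_nonneg (√b - √a)]

theorem sum_div_sqrt_le_gauge {v : ℕ → ℝ} (hv : ∀ i, 0 ≤ v i) (n : ℕ) :
    ∑ i ∈ range n, v i / √(1 + ∑ j ∈ range (i + 1), v j) ≤ 2 * gauge (∑ i ∈ range n, v i) := by
  have hV : ∀ n, 0 ≤ ∑ i ∈ range n, v i := fun n => sum_nonneg fun i _ => hv i
  refine le_trans (?_ : _ ≤ 2 * (√(1 + ∑ i ∈ range n, v i) - 1)) (by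
    linarith [sqrt_one_add_sub_one_le_gauge (hV n)])
  induction n with
  | zero => simp
  | succ n ih =>
    rw [sum_range_succ (fun i => v i / √(1 + ∑ j ∈ range (i + 1), v j))]
    have h := sub_div_sqrt_le (a := 1 + ∑ j ∈ range n, v j) (b := 1 + ∑ j ∈ range (n + 1), v j)
      (by linarith [hV n]) (by rw [sum_range_succ]; linarith [hv n])
    rw [show (1 + ∑ j ∈ range (n + 1), v j) - (1 + ∑ j ∈ range n, v j) = v n by
      rw [sum_range_succ]; ring] at h
    linarith

/-- A discrete product rule for `M ^ 2 / √(1 + V)`, where `M` and `V` are the partial sums of `m`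
and `v`; the term from the decrease of the weight is dropped. -/
theorem sq_sum_div_sqrt_le {v : ℕ → ℝ} (hv : ∀ i, 0 ≤ v i) (m : ℕ → ℝ) (n : ℕ) :
    (∑ i ∈ range n, m i) ^ 2 / √(1 + ∑ i ∈ range n, v i) ≤
      ∑ i ∈ range n, (2 * (∑ j ∈ range i, m j) * m i + m i ^ 2) /
        √(1 + ∑ j ∈ range (i + 1), v j) := by
  induction n with
  | zero => simp
  | succ n ih =>
    have hV : 0 ≤ ∑ i ∈ range n, v i := sum_nonneg fun i _ => hv i
    rw [sum_range_succ _ n, sum_range_succ (fun i => _ / _)]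
    have h : (∑ i ∈ range n, m i) ^ 2 / √(1 + ∑ i ∈ range (n + 1), v i) ≤
        (∑ i ∈ range n, m i) ^ 2 / √(1 + ∑ i ∈ range n, v i) := by
      have : 0 < √(1 + ∑ i ∈ range n, v i) := Real.sqrt_pos.2 (by linarith)
      refine div_le_div_of_nonneg_left (sq_nonneg _) this (Real.sqrt_le_sqrt ?_)
      rw [sum_range_succ]
      linarith [hv n]
    calc _ = (∑ i ∈ range n, m i) ^ 2 / √(1 + ∑ i ∈ range (n + 1), v i) +
          (2 * (∑ j ∈ range n, m j) * m n + m n ^ 2) / √(1 + ∑ j ∈ range (n + 1), v j) := by ring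
      _ ≤ _ := by linarith

theorem sum_div_sqrt_le_sum_div_sqrt {r c : ℕ → ℝ} {C : ℝ} {n : ℕ} (hr : ∀ i, 0 ≤ r i)
    (hc : ∀ i, 0 < c i) (hC : ∀ i < n, c i ≤ C) :
    (∑ i ∈ range n, r i) / √C ≤ ∑ i ∈ range n, r i / √(c i) := by
  rw [sum_div]
  refine sum_le_sum fun i hi => ?_
  have := Real.sqrt_pos.2 (hc i)
  have := hC i (mem_range.1 hi)
  have := hr i
  gcongr

theorem sum_range_le_sum_range {v : ℕ → ℝ} (hv : ∀ i, 0 ≤ v i) {m n : ℕ} (h : m ≤ n) :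
    ∑ i ∈ range m, v i ≤ ∑ i ∈ range n, v i :=
  sum_le_sum_of_subset_of_nonneg (range_mono h) fun i _ _ => hv i

/-- The weight of `q i` involves only `q j` for `j < i`, which keeps it predictable when `q` is
adapted; the summand `1` makes up for the missing term `q i ≤ 1`. -/
theorem sum_div_sqrt_le_sqrt {q v : ℕ → ℝ} (hv : ∀ i, 0 ≤ v i) (hq : ∀ i, 0 ≤ q i)
    (hq1 : ∀ i, q i ≤ 1) (n : ℕ) :
    ∑ i ∈ range n, q i / √(1 + ∑ j ∈ range (i + 1), v j + ∑ j ∈ range i, q j) ≤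
      2 * √(∑ i ∈ range n, q i) := by
  induction n with
  | zero => simp
  | succ n ih =>
    have hV : 0 ≤ ∑ i ∈ range (n + 1), v i := sum_nonneg fun i _ => hv i
    have hQ : 0 ≤ ∑ i ∈ range n, q i := sum_nonneg fun i _ => hq i
    rw [sum_range_succ (fun i => _ / _)]
    have h := sub_div_sqrt_le (a := ∑ j ∈ range n, q j) (b := ∑ j ∈ range (n + 1), q j) hQ
      (by rw [sum_range_succ]; linarith [hq n])
    have h' : q n / √(1 + ∑ j ∈ range (n + 1), v j + ∑ j ∈ range n, q j) ≤
        (∑ j ∈ range (n + 1), q j - ∑ j ∈ range n, q j) / √(∑ j ∈ range (n + 1), q j) := by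
      rw [sum_range_succ q, add_sub_cancel_left]
      rcases (hq n).eq_or_lt with h0 | h0
      · simp [← h0]
      · have : 0 < √(∑ j ∈ range n, q j + q n) := Real.sqrt_pos.2 (by linarith)
        refine div_le_div_of_nonneg_left h0.le this (Real.sqrt_le_sqrt ?_)
        linarith [hq1 n]
    linarith

theorem gauge_le_sqrt_add {V Q : ℝ} (hV : 0 ≤ V) (hQ : 0 ≤ Q) :
    gauge V ≤ 3 / 2 * (√Q + V / √(1 + V + Q)) := by
  have h2 : 0 ≤ V / √(1 + V + Q) := by positivity
  rcases le_total Q (1 + V) with h | h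
  · have h3 : √(1 + V + Q) ≤ 3 / 2 * √(1 + V) := by
      rw [Real.sqrt_le_left (by positivity), mul_pow, Real.sq_sqrt (by positivity)]
      linarith
    have h4 : gauge V ≤ 3 / 2 * (V / √(1 + V + Q)) := by
      unfold gauge
      rw [← mul_div_assoc, div_le_div_iff₀ (by positivity) (by positivity)]
      nlinarith
    linarith [Real.sqrt_nonneg Q]
  · have : gauge V ≤ √Q := (gauge_le_sqrt hV).trans (Real.sqrt_le_sqrt (by linarith))
    linarith [Real.sqrt_nonneg Q]

/-- Below total variance `1` the trivial bound by the sum `R` of the absolute increments is used,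
above it the inequality between arithmetic and geometric means. -/
theorem abs_le_of_abs_le {M R V : ℝ} (hV : 0 ≤ V) (hM : |M| ≤ R) :
    |M| ≤ 3 / 2 * (R / √(1 + V)) + 1 / 2 * (M ^ 2 / √(1 + V)) + gauge V := by
  have hR : 0 ≤ R := (abs_nonneg M).trans hM
  have hg := gauge_nonneg hV
  have hs : 0 < √(1 + V) := by positivity
  have hss : √(1 + V) * √(1 + V) = 1 + V := Real.mul_self_sqrt (by positivity)
  have h1 : 0 ≤ R / √(1 + V) := by positivity
  have h2 : 0 ≤ M ^ 2 / √(1 + V) := by positivity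
  rcases le_total V 1 with h | h
  · have : R ≤ 3 / 2 * (R / √(1 + V)) := by
      rw [← mul_div_assoc, le_div_iff₀ hs]
      have : √(1 + V) ≤ 3 / 2 := by
        rw [Real.sqrt_le_left (by norm_num)]; linarith
      nlinarith
    linarith
  · have h3 : √(1 + V) / 2 ≤ gauge V := by
      unfold gauge
      rw [le_div_iff₀ hs]
      linarith
    have h4 : |M| ≤ 1 / 2 * (M ^ 2 / √(1 + V)) + √(1 + V) / 2 := by
      rw [← sq_abs M]
      have : 1 / 2 * (|M| ^ 2 / √(1 + V)) + √(1 + V) / 2 - |M| =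
          (|M| - √(1 + V)) ^ 2 / (2 * √(1 + V)) := by field_simp; ring
      have : 0 ≤ (|M| - √(1 + V)) ^ 2 / (2 * √(1 + V)) := by positivity
      linarith
    linarith

/-! ### Expectations -/

section Expect

variable {T : ℕ} (D : Dist T)

theorem expect_add (f g : (Fin T → Bool) → ℝ) :
    expect D (fun x => f x + g x) = expect D f + expect D g := by
  simp [expect, mul_add, sum_add_distrib]

theorem expect_const_mul (c : ℝ) (f : (Fin T → Bool) → ℝ) :
    expect D (fun x => c * f x) = c * expect D f := by
  simp only [expect, mul_sum]
  exact sum_congr rfl fun x _ => by ring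

theorem expect_sum {ι : Type*} (s : Finset ι) (f : ι → (Fin T → Bool) → ℝ) :
    expect D (fun x => ∑ i ∈ s, f i x) = ∑ i ∈ s, expect D (f i) := by
  simp only [expect, mul_sum]
  exact sum_comm

theorem expect_const (c : ℝ) : expect D (fun _ => c) = c := by
  simp [expect, ← sum_mul, D.2.2]

theorem expect_mono {f g : (Fin T → Bool) → ℝ} (h : ∀ x, f x ≤ g x) : expect D f ≤ expect D g :=
  sum_le_sum fun x _ => mul_le_mul_of_nonneg_left (h x) (D.2.1 x)

theorem abs_expect_le (f : (Fin T → Bool) → ℝ) : |expect D f| ≤ expect D fun x => |f x| :=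
  (abs_sum_le_sum_abs _ _).trans_eq
    (sum_congr rfl fun x _ => by rw [abs_mul, abs_of_nonneg (D.2.1 x)])

end Expect

/-! ### Conditional means -/

section CondMean

variable {T : ℕ}

/-- The `n`-th outcome as a real number, extended by `0` beyond the horizon. -/
noncomputable def outcome (x : Fin T → Bool) (n : ℕ) : ℝ := if h : n < T then (bit (x ⟨n, h⟩) : ℝ) else 0

/-- The `n`-th prediction of `A` on `x` as a real number, extended by `0` beyond the horizon. -/
noncomputable def forecast (A : Forecaster T) (x : Fin T → Bool) (n : ℕ) : ℝ :=
  if h : n < T then (A.predict x ⟨n, h⟩ : ℝ) else 0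

/-- The variance `p (1 - p)` of a Bernoulli variable whose parameter `p` is the `n`-th prediction
of `A` on `x`. -/
noncomputable def predVar (A : Forecaster T) (x : Fin T → Bool) (n : ℕ) : ℝ :=
  forecast A x n * (1 - forecast A x n)

/-- The forecaster `A` predicts conditional means under `D`: the error of the `n`-th prediction is
orthogonal to all functions of the outcomes before step `n`. -/
def IsCondMean (D : Dist T) (A : Forecaster T) : Prop :=
  ∀ (n : ℕ) (φ : (Fin T → Bool) → ℝ), DependsOn φ {i : Fin T | (i : ℕ) < n} →
    expect D (fun x => φ x * (outcome x n - forecast A x n)) = 0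

theorem outcome_sq (x : Fin T → Bool) (n : ℕ) : outcome x n ^ 2 = outcome x n := by
  unfold outcome bit; split_ifs <;> simp

theorem outcome_mem (x : Fin T → Bool) (n : ℕ) : outcome x n = 0 ∨ outcome x n = 1 := by
  unfold outcome bit; split_ifs <;> simp

theorem forecast_nonneg (A : Forecaster T) (x : Fin T → Bool) (n : ℕ) : 0 ≤ forecast A x n := by
  unfold forecast; split_ifs
  · exact (A.predict x _).2.1
  · exact le_rfl

theorem forecast_le_one (A : Forecaster T) (x : Fin T → Bool) (n : ℕ) : forecast A x n ≤ 1 := by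
  unfold forecast; split_ifs
  · exact (A.predict x _).2.2
  · exact zero_le_one

theorem predVar_nonneg (A : Forecaster T) (x : Fin T → Bool) (n : ℕ) : 0 ≤ predVar A x n :=
  mul_nonneg (forecast_nonneg A x n) (sub_nonneg.2 (forecast_le_one A x n))

theorem predVar_le_one (A : Forecaster T) (x : Fin T → Bool) (n : ℕ) : predVar A x n ≤ 1 :=
  mul_le_one₀ (forecast_le_one A x n) (sub_nonneg.2 (forecast_le_one A x n))
    (by linarith [forecast_nonneg A x n])

theorem sq_error_eq (A : Forecaster T) (x : Fin T → Bool) (n : ℕ) :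
    (outcome x n - forecast A x n) ^ 2 =
      (1 - 2 * forecast A x n) * (outcome x n - forecast A x n) + predVar A x n := by
  have := outcome_sq x n
  unfold predVar; linear_combination this

theorem abs_error_eq (A : Forecaster T) (x : Fin T → Bool) (n : ℕ) :
    |outcome x n - forecast A x n| =
      (1 - 2 * forecast A x n) * (outcome x n - forecast A x n) + 2 * predVar A x n := by
  have h0 := forecast_nonneg A x n
  have h1 := forecast_le_one A x n
  unfold predVar
  rcases outcome_mem x n with h | h <;> rw [h]
  · rw [abs_of_nonpos (by linarith)]; ring
  · rw [abs_of_nonneg (by linarith)]; ring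

theorem sq_error_le_one (A : Forecaster T) (x : Fin T → Bool) (n : ℕ) :
    (outcome x n - forecast A x n) ^ 2 ≤ 1 := by
  have h0 := forecast_nonneg A x n
  have h1 := forecast_le_one A x n
  rcases outcome_mem x n with h | h <;> rw [h] <;> nlinarith

theorem outcome_congr {x y : Fin T → Bool} {n m : ℕ} (h : ∀ i : Fin T, (i : ℕ) < n → x i = y i)
    (hm : m < n) : outcome x m = outcome y m := by
  unfold outcome; split_ifs with hT
  · rw [h ⟨m, hT⟩ hm]
  · rfl

theorem forecast_congr (A : Forecaster T) {x y : Fin T → Bool} {n m : ℕ}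
    (h : ∀ i : Fin T, (i : ℕ) < n → x i = y i) (hm : m ≤ n) : forecast A x m = forecast A y m := by
  unfold forecast Forecaster.predict; split_ifs with hT
  · have : history x ⟨m, hT⟩ = history y ⟨m, hT⟩ := by
      funext s
      exact h _ (lt_of_lt_of_le s.2 hm)
    rw [this]
  · rfl

theorem sum_predVar_congr (A : Forecaster T) {x y : Fin T → Bool} {n m : ℕ}
    (h : ∀ i : Fin T, (i : ℕ) < n → x i = y i) (hm : m ≤ n + 1) :
    ∑ j ∈ range m, predVar A x j = ∑ j ∈ range m, predVar A y j := by
  refine sum_congr rfl fun j hj => ?_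
  have : j ≤ n := by have := mem_range.1 hj; omega
  unfold predVar
  rw [forecast_congr A h this]

/-- The first absolute moment of a martingale transform of the prediction errors is controlled by
the expected gauge of the accumulated predictable variance `V`. The square of the transform and the
sum of the absolute errors, both divided by `√(1 + V)`, are compared with sums whose terms are
divided by the partial values of `√(1 + V)`; these are predictable. -/
theorem expect_abs_transform_le {D : Dist T} {A : Forecaster T} (hA : IsCondMean D A)
    (a : (Fin T → Bool) → ℕ → ℝ) (ha : ∀ n, DependsOn (fun x => a x n) {i : Fin T | (i : ℕ) < n})
    (ha1 : ∀ x n, |a x n| ≤ 1) :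
    expect D (fun x => |∑ n ∈ range T, a x n * (outcome x n - forecast A x n)|) ≤
      8 * expect D (fun x => gauge (∑ n ∈ range T, predVar A x n)) := by
  set G := expect D (fun x => gauge (∑ n ∈ range T, predVar A x n)) with hG
  set ξ : (Fin T → Bool) → ℕ → ℝ := fun x n => outcome x n - forecast A x n with hξ
  set w : (Fin T → Bool) → ℕ → ℝ := fun x n => √(1 + ∑ j ∈ range n, predVar A x j) with hw
  have hV : ∀ x n, 0 ≤ ∑ j ∈ range n, predVar A x j := fun x n =>
    sum_nonneg fun j _ => predVar_nonneg A x j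
  have hw0 : ∀ x n, 0 < w x n := fun x n => Real.sqrt_pos.2 (by linarith [hV x n])
  have hwc : ∀ {x y : Fin T → Bool} {n : ℕ}, (∀ i : Fin T, (i : ℕ) < n → x i = y i) →
      w x (n + 1) = w y (n + 1) := fun h => by
    simp only [hw]; rw [sum_predVar_congr A h le_rfl]
  have hvar : expect D (fun x => ∑ n ∈ range T, predVar A x n / w x (n + 1)) ≤ 2 * G := by
    rw [hG, ← expect_const_mul]
    exact expect_mono D fun x => sum_div_sqrt_le_gauge (predVar_nonneg A x) T
  have hR : expect D (fun x => (∑ n ∈ range T, |ξ x n|) / w x T) ≤ 4 * G := by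
    calc _ ≤ expect D (fun x => ∑ n ∈ range T, |ξ x n| / w x (n + 1)) := by
          refine expect_mono D fun x => sum_div_sqrt_le_sum_div_sqrt (fun i => abs_nonneg _)
            (fun i => ?_) fun i hi => ?_
          · linarith [hV x (i + 1)]
          · linarith [sum_range_le_sum_range (predVar_nonneg A x) (Nat.succ_le_of_lt hi)]
      _ = expect D (fun x => 2 * ∑ n ∈ range T, predVar A x n / w x (n + 1)) +
            ∑ n ∈ range T, expect D (fun x => (1 - 2 * forecast A x n) / w x (n + 1) * ξ x n) := by
          rw [← expect_sum, ← expect_add]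
          congr 1; funext x
          rw [mul_sum, ← sum_add_distrib]
          refine sum_congr rfl fun n _ => ?_
          simp only [hξ]
          rw [abs_error_eq]; ring
      _ = 2 * expect D (fun x => ∑ n ∈ range T, predVar A x n / w x (n + 1)) := by
          rw [sum_eq_zero fun n _ => hA n _ fun x y h => ?_, add_zero, expect_const_mul]
          rw [hwc h, forecast_congr A h le_rfl]
      _ ≤ 4 * G := by linarith
  have hM : expect D (fun x => (∑ n ∈ range T, a x n * ξ x n) ^ 2 / w x T) ≤ 2 * G := by
    calc _ ≤ expect D (fun x => ∑ n ∈ range T,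
            (2 * (∑ j ∈ range n, a x j * ξ x j) * (a x n * ξ x n) + (a x n * ξ x n) ^ 2) /
              w x (n + 1)) :=
          expect_mono D fun x => sq_sum_div_sqrt_le (predVar_nonneg A x) _ T
      _ ≤ expect D (fun x => ∑ n ∈ range T, predVar A x n / w x (n + 1) + ∑ n ∈ range T,
            (2 * (∑ j ∈ range n, a x j * ξ x j) * a x n + a x n ^ 2 * (1 - 2 * forecast A x n)) /
              w x (n + 1) * ξ x n) := by
          refine expect_mono D fun x => ?_
          rw [← sum_add_distrib]
          refine sum_le_sum fun n _ => ?_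
          rw [div_mul_eq_mul_div, ← add_div]
          have hsq : a x n ^ 2 ≤ 1 := (sq_le_one_iff_abs_le_one _).2 (ha1 x n)
          have h1 := sq_error_eq A x n
          have h2 := mul_le_mul_of_nonneg_right hsq (predVar_nonneg A x n)
          have := hw0 x (n + 1)
          refine div_le_div_of_nonneg_right ?_ this.le
          rw [mul_pow]
          simp only [hξ] at h1 ⊢
          rw [h1]
          linarith
      _ = expect D (fun x => ∑ n ∈ range T, predVar A x n / w x (n + 1)) := by
          rw [expect_add, expect_sum D _ (fun n x => _ / w x (n + 1) * ξ x n),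
            sum_eq_zero fun n _ => hA n _ fun x y h => ?_, add_zero]
          have hs : ∑ j ∈ range n, a x j * ξ x j = ∑ j ∈ range n, a y j * ξ y j := by
            refine sum_congr rfl fun j hj => ?_
            have hj := mem_range.1 hj
            have h3 : a x j = a y j := ha j fun i hi => h i (lt_trans hi hj)
            simp only [hξ]
            rw [h3, outcome_congr h hj, forecast_congr A h hj.le]
          have h4 : a x n = a y n := ha n h
          rw [hwc h, forecast_congr A h le_rfl, hs, h4]
      _ ≤ 2 * G := hvar
  calc _ ≤ expect D (fun x => 3 / 2 * ((∑ n ∈ range T, |ξ x n|) / w x T) +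
          1 / 2 * ((∑ n ∈ range T, a x n * ξ x n) ^ 2 / w x T) +
          gauge (∑ n ∈ range T, predVar A x n)) := by
        refine expect_mono D fun x => abs_le_of_abs_le (hV x T) ?_
        refine (abs_sum_le_sum_abs _ _).trans (sum_le_sum fun n _ => ?_)
        rw [abs_mul]
        exact mul_le_of_le_one_left (abs_nonneg _) (ha1 x n)
    _ ≤ _ := by
        rw [expect_add, expect_add, expect_const_mul, expect_const_mul]
        linarith

/-- Whatever forecaster `B` is used, the Euclidean norm of its prediction errors dominates the
gauge of the predictable variance in expectation: conditionally on the past, no prediction has a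
smaller mean square error than the conditional mean. -/
theorem expect_gauge_le_expect_sqrt {D : Dist T} {A : Forecaster T} (hA : IsCondMean D A)
    (B : Forecaster T) :
    expect D (fun x => gauge (∑ n ∈ range T, predVar A x n)) ≤
      9 / 2 * expect D (fun x => √(∑ n ∈ range T, (outcome x n - forecast B x n) ^ 2)) := by
  set q : (Fin T → Bool) → ℕ → ℝ := fun x n => (outcome x n - forecast B x n) ^ 2 with hq
  set w : (Fin T → Bool) → ℕ → ℝ := fun x n =>
    √(1 + ∑ j ∈ range (n + 1), predVar A x j + ∑ j ∈ range n, q x j) with hw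
  have hq0 : ∀ x n, 0 ≤ q x n := fun x n => sq_nonneg _
  have hV : ∀ x n, 0 ≤ ∑ j ∈ range n, predVar A x j := fun x n =>
    sum_nonneg fun j _ => predVar_nonneg A x j
  have hQ : ∀ x n, 0 ≤ ∑ j ∈ range n, q x j := fun x n => sum_nonneg fun j _ => hq0 x j
  have hw0 : ∀ x n, 0 < w x n := fun x n =>
    Real.sqrt_pos.2 (by linarith [hV x (n + 1), hQ x n])
  have key : expect D (fun x => (∑ n ∈ range T, predVar A x n) /
      √(1 + ∑ n ∈ range T, predVar A x n + ∑ n ∈ range T, q x n)) ≤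
        2 * expect D (fun x => √(∑ n ∈ range T, q x n)) := by
    calc _ ≤ expect D (fun x => ∑ n ∈ range T, predVar A x n / w x n) := by
          refine expect_mono D fun x => sum_div_sqrt_le_sum_div_sqrt (predVar_nonneg A x)
            (fun i => ?_) fun i hi => ?_
          · linarith [hV x (i + 1), hQ x i]
          · linarith [sum_range_le_sum_range (predVar_nonneg A x) (Nat.succ_le_of_lt hi),
              sum_range_le_sum_range (hq0 x) hi.le]
      _ = expect D (fun x => ∑ n ∈ range T, predVar A x n / w x n) + ∑ n ∈ range T,
            expect D (fun x => (1 - 2 * forecast B x n) / w x n *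
              (outcome x n - forecast A x n)) := by
          rw [sum_eq_zero fun n _ => hA n _ fun x y h => ?_, add_zero]
          have hs : ∑ j ∈ range n, q x j = ∑ j ∈ range n, q y j := by
            refine sum_congr rfl fun j hj => ?_
            have hj := mem_range.1 hj
            simp only [hq]
            rw [outcome_congr h hj, forecast_congr B h hj.le]
          simp only [hw]
          rw [forecast_congr B h le_rfl, sum_predVar_congr A h le_rfl, hs]
      _ ≤ expect D (fun x => ∑ n ∈ range T, q x n / w x n) := by
          rw [← expect_sum, ← expect_add]
          refine expect_mono D fun x => ?_
          rw [← sum_add_distrib]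
          refine sum_le_sum fun n _ => ?_
          rw [div_mul_eq_mul_div, ← add_div]
          have := hw0 x n
          gcongr
          have := outcome_sq x n
          simp only [hq]
          unfold predVar
          nlinarith [sq_nonneg (forecast A x n - forecast B x n)]
      _ ≤ 2 * expect D (fun x => √(∑ n ∈ range T, q x n)) := by
          rw [← expect_const_mul]
          exact expect_mono D fun x => sum_div_sqrt_le_sqrt (predVar_nonneg A x) (hq0 x)
            (sq_error_le_one B x) T
  calc _ ≤ expect D (fun x => 3 / 2 * (√(∑ n ∈ range T, q x n) + (∑ n ∈ range T, predVar A x n) /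
        √(1 + ∑ n ∈ range T, predVar A x n + ∑ n ∈ range T, q x n))) :=
        expect_mono D fun x => gauge_le_sqrt_add (hV x T) (hQ x T)
    _ ≤ _ := by
        rw [expect_const_mul, expect_add]
        linarith

theorem isCondMean_truthful (D : Dist T) : IsCondMean D (truthful D) := by
  intro n φ hφ
  unfold expect outcome forecast
  split_ifs with hn
  swap
  · simp
  set t : Fin T := ⟨n, hn⟩ with ht
  rw [← sum_fiberwise (s := univ) (g := fun x => history x t)]
  refine sum_eq_zero fun b _ => ?_
  rcases (univ.filter fun x : Fin T → Bool => history x t = b).eq_empty_or_nonempty with he | ⟨y, hy⟩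
  · rw [he, sum_empty]
  have hy : history y t = b := (mem_filter.1 hy).2
  have hP0 : 0 ≤ prob D {x | history x t = b ∧ x t = true} := sum_nonneg fun x _ => D.2.1 x
  have hP : prob D {x | history x t = b ∧ x t = true} ≤ prob D {x | history x t = b} :=
    sum_le_sum_of_subset_of_nonneg (fun x hx => by
      simp only [mem_filter] at hx ⊢; exact ⟨hx.1, hx.2.1⟩) fun x _ _ => D.2.1 x
  set P := prob D {x | history x t = b} with hPd
  set P1 := prob D {x | history x t = b ∧ x t = true} with hP1d
  calc _ = ∑ x with history x t = b, φ y * (D.1 x * (bit (x t) : ℝ) - P1 / P * D.1 x) := by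
        refine sum_congr rfl fun x hx => ?_
        have hx : history x t = b := (mem_filter.1 hx).2
        have h1 : φ x = φ y := hφ fun i hi => congrFun (hx.trans hy.symm) ⟨i, hi⟩
        have h2 : ((truthful D).predict x t : ℝ) = P1 / P := by
          simp only [Forecaster.predict, truthful, hx, hPd, hP1d]
        simp only; rw [h1, h2]; ring
    _ = φ y * (P1 - P1 / P * P) := by
        rw [← mul_sum, sum_sub_distrib, ← mul_sum]
        congr 2
        rw [hP1d, prob, ← filter_filter, sum_filter (s := univ.filter _)]
        refine sum_congr rfl fun x _ => ?_
        cases x t <;> simp [bit]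
    _ = 0 := by
        rcases eq_or_ne P 0 with h | h
        · have : P1 = 0 := by linarith
          simp [this]
        · field_simp; simp

theorem isCondMean_iidBernoulli (α : I) : IsCondMean (iidBernoulli T α) fun _ _ => α := by
  intro n φ hφ
  unfold expect outcome forecast
  split_ifs with hn
  swap
  · simp
  -- Flipping the `n`-th outcome pairs off the terms of the expectation.
  refine sum_involution (fun x _ => Function.update x ⟨n, hn⟩ (!x ⟨n, hn⟩)) ?_ ?_ ?_ ?_
  · intro x _
    have h1 : φ (Function.update x ⟨n, hn⟩ (!x ⟨n, hn⟩)) = φ x := hφ fun i hi =>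
      Function.update_of_ne (fun h => by
        have hi : (i : ℕ) < n := hi
        simp [h] at hi) _ _
    have h2 : ∀ b, (iidBernoulli T α).1 (Function.update x ⟨n, hn⟩ b) =
        (if b then (α : ℝ) else 1 - α) *
          ∏ t ∈ univ.erase ⟨n, hn⟩, if x t then (α : ℝ) else 1 - α := by
      intro b
      simp only [iidBernoulli]
      rw [← mul_prod_erase univ _ (mem_univ (⟨n, hn⟩ : Fin T)), Function.update_self]
      congr 1
      exact prod_congr rfl fun t ht => by rw [Function.update_of_ne (ne_of_mem_erase ht)]
    have h3 := h2 (x ⟨n, hn⟩)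
    rw [Function.update_eq_self] at h3
    simp only; rw [h1, h2, h3, Function.update_self]
    cases x ⟨n, hn⟩ <;> simp [bit, Forecaster.predict] <;> ring
  · intro x _ _ h
    have := congrFun h ⟨n, hn⟩
    simp at this
  · simp
  · simp

end CondMean

/-! ### Bounds for the smooth calibration error -/

section SmCE

variable {ι : Type} [Fintype ι] (x : ι → Bool) (p : ι → I)

theorem le_smCE {f : I → ℝ} (hf : f ∈ lipFamily) :
    ∑ i, f (p i) * ((bit (x i) : ℝ) - p i) ≤ smCE x p :=
  le_ciSup (f := fun f : lipFamily => ∑ i, f.1 (p i) * ((bit (x i) : ℝ) - p i))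
    ⟨Fintype.card ι, by rintro _ ⟨f, rfl⟩; exact sum_le_card x p f⟩ ⟨f, hf⟩

theorem smCE_le {B : ℝ} (h : ∀ f ∈ lipFamily, ∑ i, f (p i) * ((bit (x i) : ℝ) - p i) ≤ B) :
    smCE x p ≤ B :=
  have : Nonempty lipFamily := ⟨⟨_, zero_mem_lipFamily⟩⟩
  ciSup_le fun f => h f.1 f.2

theorem const_mem_lipFamily {c : ℝ} (hc : |c| ≤ 1) : (fun _ : I => c) ∈ lipFamily :=
  ⟨(LipschitzWith.const c).weaken zero_le_one, fun _ => abs_le.1 hc⟩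

theorem abs_sum_le_smCE : |∑ i, ((bit (x i) : ℝ) - p i)| ≤ smCE x p := by
  refine abs_le'.2 ⟨?_, ?_⟩
  · simpa using le_smCE x p (const_mem_lipFamily (c := 1) (by simp))
  · simpa using le_smCE x p (const_mem_lipFamily (c := -1) (by simp))

/-- A `1`-Lipschitz function on `[0,1]` is, up to `1 / N`, a constant plus a combination of the
indicators of `[(j + 1) / N, 1]` for `j < N` with coefficients of size at most `1 / N`. -/
theorem exists_step_approx {f : I → ℝ} (hf : f ∈ lipFamily) {N : ℕ} (hN : 0 < N) :
    ∃ d : ℕ → ℝ, (∀ j, |d j| ≤ 1 / N) ∧ ∀ z : I, |f z - (f 0 +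
      ∑ j ∈ range N, d j * if ((j + 1 : ℕ) : ℝ) / N ≤ z then 1 else 0)| ≤ 1 / N := by
  have hN' : (0 : ℝ) < N := Nat.cast_pos.2 hN
  set F : ℝ → ℝ := Set.IccExtend zero_le_one f with hF
  have hFL : ∀ a b, |F a - F b| ≤ |a - b| := fun a b => by
    have h := (hf.1.comp (LipschitzWith.projIcc (zero_le_one (α := ℝ)))).dist_le_mul a b
    simpa [Real.dist_eq, hF, Set.IccExtend] using h
  have hFz : ∀ z : I, F z = f z := fun z => Set.IccExtend_val zero_le_one f z
  refine ⟨fun j => F ((j + 1 : ℕ) / N) - F (j / N), fun j => (hFL _ _).trans_eq ?_, fun z => ?_⟩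
  · rw [← sub_div, Nat.cast_succ, add_sub_cancel_left, abs_of_pos (by positivity)]
  · set k := ⌊(z : ℝ) * N⌋₊ with hk
    have hzN : 0 ≤ (z : ℝ) * N := mul_nonneg z.2.1 hN'.le
    have hkN : k ≤ N := by
      have : (k : ℝ) ≤ N := (Nat.floor_le hzN).trans (mul_le_of_le_one_left hN'.le z.2.2)
      exact_mod_cast this
    have hfil : (range N).filter (fun j => ((j + 1 : ℕ) : ℝ) / N ≤ z) = range k := by
      ext j
      rw [mem_filter, mem_range, mem_range, div_le_iff₀ hN', ← Nat.le_floor_iff hzN, ← hk]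
      omega
    have hF0 : F ((0 : ℕ) / N) = f 0 := by
      rw [← hFz 0]; simp
    simp only [mul_ite, mul_one, mul_zero]
    rw [← sum_filter, hfil, sum_range_sub (fun j => F ((j : ℕ) / N)), hF0, add_sub_cancel, ← hFz]
    refine (hFL _ _).trans ?_
    have h1 := Nat.floor_le hzN
    have h2 := Nat.lt_floor_add_one ((z : ℝ) * N)
    rw [← hk] at h1 h2
    have : (z : ℝ) - k / N = (z * N - k) / N := by field_simp
    rw [this, abs_of_nonneg (div_nonneg (by linarith) hN'.le)]
    gcongr
    linarith

/-- The smooth calibration error is at most the bias plus the average, over thresholds `u`, of the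
bias on the steps with prediction at least `u`, up to the mesh of the grid of thresholds. -/
theorem smCE_le_average {N : ℕ} (hN : 0 < N) :
    smCE x p ≤ |∑ i, ((bit (x i) : ℝ) - p i)| +
      1 / N * ∑ j ∈ range N,
        |∑ i, (if ((j + 1 : ℕ) : ℝ) / N ≤ p i then 1 else 0) * ((bit (x i) : ℝ) - p i)| +
      Fintype.card ι * (1 / N) := by
  refine smCE_le x p fun f hf => ?_
  obtain ⟨d, hd, hfd⟩ := exists_step_approx hf hN
  set ξ : ι → ℝ := fun i => (bit (x i) : ℝ) - p i with hξ
  set s : ℕ → ι → ℝ := fun j i => if ((j + 1 : ℕ) : ℝ) / N ≤ p i then 1 else 0 with hs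
  have hξ1 : ∀ i, |ξ i| ≤ 1 := fun i => abs_le.2
    ⟨by linarith [(bit (x i)).2.1, (p i).2.2], by linarith [(bit (x i)).2.2, (p i).2.1]⟩
  calc ∑ i, f (p i) * ξ i
      = f 0 * ∑ i, ξ i + ∑ j ∈ range N, d j * ∑ i, s j i * ξ i +
          ∑ i, (f (p i) - (f 0 + ∑ j ∈ range N, d j * s j i)) * ξ i := by
        simp only [mul_sum]
        rw [sum_comm (s := range N), ← sum_add_distrib, ← sum_add_distrib]
        refine sum_congr rfl fun i _ => ?_
        have : ∑ j ∈ range N, d j * (s j i * ξ i) = (∑ j ∈ range N, d j * s j i) * ξ i := by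
          rw [sum_mul]; exact sum_congr rfl fun j _ => by ring
        rw [this]; ring
    _ ≤ |∑ i, ξ i| + ∑ j ∈ range N, 1 / N * |∑ i, s j i * ξ i| + ∑ _i : ι, (1 / N : ℝ) := by
        refine add_le_add (add_le_add ?_ (sum_le_sum fun j _ => ?_)) (sum_le_sum fun i _ => ?_)
        · refine (le_abs_self _).trans ?_
          rw [abs_mul]
          exact mul_le_of_le_one_left (abs_nonneg _) (abs_le.2 (hf.2 0))
        · refine (le_abs_self _).trans ?_
          rw [abs_mul]
          exact mul_le_mul_of_nonneg_right (hd j) (abs_nonneg _)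
        · refine (le_abs_self _).trans ?_
          rw [abs_mul]
          exact (mul_le_of_le_one_right (abs_nonneg _) (hξ1 i)).trans (hfd (p i))
    _ = _ := by rw [← mul_sum, sum_const, nsmul_eq_mul, card_univ]

end SmCE

/-! ### Sums over random subsets -/

section Subsets

variable {ι : Type*} [DecidableEq ι] (a : ι → ℝ)

/-- The sum of `± a i` over `i ∈ s`, with sign `+` exactly for `i ∈ S`. -/
def signedSum (s S : Finset ι) : ℝ := ∑ i ∈ s, if i ∈ S then a i else -a i

theorem sum_powerset_insert_signedSum (F : ℝ → ℝ) {s : Finset ι} {b : ι} (hb : b ∉ s) :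
    ∑ S ∈ (insert b s).powerset, F (signedSum a (insert b s) S) =
      ∑ S ∈ s.powerset, (F (signedSum a s S - a b) + F (signedSum a s S + a b)) := by
  rw [sum_powerset_insert hb, ← sum_add_distrib]
  refine sum_congr rfl fun S hS => ?_
  have hbS : b ∉ S := fun h => hb (mem_powerset.1 hS h)
  have h1 : signedSum a (insert b s) S = signedSum a s S - a b := by
    unfold signedSum
    rw [sum_insert hb, if_neg hbS]; ring
  have h2 : signedSum a (insert b s) (insert b S) = signedSum a s S + a b := by
    unfold signedSum
    rw [sum_insert hb, if_pos (mem_insert_self _ _), add_comm]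
    congr 1
    refine sum_congr rfl fun i hi => ?_
    have : i ≠ b := fun h => hb (h ▸ hi)
    simp [mem_insert, this]
  rw [h1, h2]

theorem sum_signedSum_sq (s : Finset ι) :
    ∑ S ∈ s.powerset, signedSum a s S ^ 2 = 2 ^ #s * ∑ i ∈ s, a i ^ 2 := by
  induction s using Finset.induction_on with
  | empty => simp [signedSum]
  | insert b s hb ih =>
    rw [sum_powerset_insert_signedSum a (· ^ 2) hb, card_insert_of_notMem hb, sum_insert hb]
    calc _ = ∑ S ∈ s.powerset, (2 * signedSum a s S ^ 2 + 2 * a b ^ 2) :=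
          sum_congr rfl fun S _ => by ring
      _ = _ := by
          rw [sum_add_distrib, ← mul_sum, ih, sum_const, card_powerset, nsmul_eq_mul]
          push_cast; ring

theorem sum_signedSum_pow_four_le (s : Finset ι) :
    ∑ S ∈ s.powerset, signedSum a s S ^ 4 ≤ 2 ^ #s * (3 * (∑ i ∈ s, a i ^ 2) ^ 2) := by
  induction s using Finset.induction_on with
  | empty => simp [signedSum]
  | insert b s hb ih =>
    rw [sum_powerset_insert_signedSum a (· ^ 4) hb, card_insert_of_notMem hb, sum_insert hb]
    calc _ = ∑ S ∈ s.powerset,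
            (2 * signedSum a s S ^ 4 + 12 * a b ^ 2 * signedSum a s S ^ 2 + 2 * a b ^ 4) :=
          sum_congr rfl fun S _ => by ring
      _ = 2 * ∑ S ∈ s.powerset, signedSum a s S ^ 4 +
            2 ^ #s * (12 * a b ^ 2 * ∑ i ∈ s, a i ^ 2 + 2 * a b ^ 4) := by
          rw [sum_add_distrib, sum_add_distrib, ← mul_sum, ← mul_sum, sum_signedSum_sq, sum_const,
            card_powerset, nsmul_eq_mul]
          push_cast; ring
      _ ≤ 2 * (2 ^ #s * (3 * (∑ i ∈ s, a i ^ 2) ^ 2)) +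
            2 ^ #s * (12 * a b ^ 2 * ∑ i ∈ s, a i ^ 2 + 6 * a b ^ 4) := by
          gcongr; norm_num
      _ = _ := by ring

/-- Khintchine's inequality for the first moment, from the second and fourth moments. -/
theorem sqrt_le_sum_abs_signedSum (s : Finset ι) :
    2 ^ #s * (5 / 9 * √(∑ i ∈ s, a i ^ 2)) ≤ ∑ S ∈ s.powerset, |signedSum a s S| := by
  have hq : 0 ≤ ∑ i ∈ s, a i ^ 2 := sum_nonneg fun i _ => sq_nonneg _
  set r := √(∑ i ∈ s, a i ^ 2) with hr
  have hr2 : r ^ 2 = ∑ i ∈ s, a i ^ 2 := Real.sq_sqrt hq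
  rcases (Real.sqrt_nonneg (∑ i ∈ s, a i ^ 2)).eq_or_lt with h0 | h0
  · rw [hr, ← h0, mul_zero, mul_zero]
    exact sum_nonneg fun S _ => abs_nonneg _
  rw [← hr] at h0
  -- The polynomial is tangent to `r ^ 3 * |X|` at `|X| = 3 * r / 2`.
  have hpt : ∀ X : ℝ, r ^ 2 * X ^ 2 - 4 / 27 * X ^ 4 ≤ r ^ 3 * |X| := fun X => by
    have h : r ^ 3 * |X| - (r ^ 2 * |X| ^ 2 - 4 / 27 * |X| ^ 4) =
        |X| * (r - 2 / 3 * |X|) ^ 2 * (r + |X| / 3) := by ring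
    have h' : 0 ≤ |X| * (r - 2 / 3 * |X|) ^ 2 * (r + |X| / 3) := by positivity
    rw [sq_abs, show |X| ^ 4 = X ^ 4 from Even.pow_abs (by decide) X] at h
    linarith
  have h1 : r ^ 2 * (2 ^ #s * r ^ 2) - 4 / 27 * (2 ^ #s * (3 * (r ^ 2) ^ 2)) ≤
      r ^ 3 * ∑ S ∈ s.powerset, |signedSum a s S| := by
    calc _ ≤ r ^ 2 * ∑ S ∈ s.powerset, signedSum a s S ^ 2 -
          4 / 27 * ∑ S ∈ s.powerset, signedSum a s S ^ 4 := by
          have := sum_signedSum_pow_four_le a s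
          rw [sum_signedSum_sq, hr2]
          linarith
      _ = ∑ S ∈ s.powerset, (r ^ 2 * signedSum a s S ^ 2 - 4 / 27 * signedSum a s S ^ 4) := by
          rw [mul_sum, mul_sum, sum_sub_distrib]
      _ ≤ _ := by
          rw [mul_sum]
          exact sum_le_sum fun S _ => hpt _
  refine le_of_mul_le_mul_left (le_trans (le_of_eq ?_) h1) (pow_pos h0 3)
  ring

theorem sum_compl_eq [Fintype ι] (F : Finset ι → ℝ) : ∑ S, F Sᶜ = ∑ S, F S :=
  Equiv.sum_comp (compl_involutive (α := Finset ι)).toPerm F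

/-- A random subset sum has first absolute moment of the order of the Euclidean norm: the subset
sums over `S` and over its complement differ by a sum with random signs. -/
theorem sqrt_le_sum_abs_subset_sum [Fintype ι] :
    2 ^ Fintype.card ι * (5 / 18 * √(∑ i, a i ^ 2)) ≤ ∑ S : Finset ι, |∑ i ∈ S, a i| := by
  have h := sqrt_le_sum_abs_signedSum a univ
  rw [powerset_univ, card_univ] at h
  have h1 : ∑ S, |signedSum a univ S| ≤ ∑ S : Finset ι, (|∑ i ∈ S, a i| + |∑ i ∈ Sᶜ, a i|) := by
    refine sum_le_sum fun S _ => ?_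
    have : signedSum a univ S = ∑ i ∈ S, a i - ∑ i ∈ Sᶜ, a i := by
      rw [signedSum, ← sum_add_sum_compl S, sub_eq_add_neg, ← sum_neg_distrib]
      congr 1
      · exact sum_congr rfl fun i hi => if_pos hi
      · exact sum_congr rfl fun i hi => if_neg (mem_compl.1 hi)
    rw [this]
    exact abs_sub _ _
  rw [sum_add_distrib, sum_compl_eq fun S => |∑ i ∈ S, a i|] at h1
  linarith

theorem sum_card_subsets [Fintype ι] :
    ∑ S : Finset ι, (#S : ℝ) = 2 ^ Fintype.card ι * (Fintype.card ι / 2) := by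
  have h : ∑ S : Finset ι, ((#S : ℝ) + #Sᶜ) = 2 ^ Fintype.card ι * Fintype.card ι := by
    rw [sum_congr rfl fun S _ => (by exact_mod_cast card_add_card_compl S :
      (#S : ℝ) + #Sᶜ = Fintype.card ι)]
    simp
  rw [sum_add_distrib, sum_compl_eq fun S => (#S : ℝ)] at h
  linarith

end Subsets

/-! ### Bounds for the subsampled error -/

section SSCE

variable {T : ℕ}

theorem sqrt_le_penalty (x : Fin T → Bool) (p : Fin T → I) :
    5 / 18 * √(∑ i, ((bit (x i) : ℝ) - p i) ^ 2) ≤ SSCE.penalty T x p := by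
  simp only [SSCE]
  rw [le_div_iff₀ (by positivity), mul_comm]
  have h := sqrt_le_sum_abs_subset_sum fun i => (bit (x i) : ℝ) - p i
  rw [Fintype.card_fin] at h
  refine h.trans (sum_le_sum fun S _ => ?_)
  rw [← sum_coe_sort]
  exact abs_sum_le_smCE _ _

/-- The indicators of `i ∈ S` and of `u ≤ p i` are predictable at step `i`. -/
theorem expect_abs_threshold_le {D : Dist T} {A : Forecaster T} (hA : IsCondMean D A)
    (S : Finset (Fin T)) (u : ℝ) :
    expect D (fun x => |∑ i : S, (if u ≤ A.predict x i then 1 else 0) *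
      ((bit (x i) : ℝ) - A.predict x i)|) ≤
        8 * expect D (fun x => gauge (∑ n ∈ range T, predVar A x n)) := by
  have h := expect_abs_transform_le hA (fun x n =>
    (if h : n < T then if (⟨n, h⟩ : Fin T) ∈ S then (1 : ℝ) else 0 else 0) *
      if u ≤ forecast A x n then 1 else 0) (fun n x y h => by
        simp only; rw [forecast_congr A h le_rfl]) (fun x n => by split_ifs <;> simp)
  refine le_trans (le_of_eq ?_) h
  congr 1; funext x
  rw [sum_coe_sort S fun i => (if u ≤ A.predict x i then (1 : ℝ) else 0) *
      ((bit (x i) : ℝ) - A.predict x i), sum_range]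
  congr 1
  simp only [outcome, forecast, Fin.is_lt, dif_pos, Fin.eta, mul_assoc]
  simp only [ite_mul, one_mul, zero_mul, sum_ite_mem, univ_inter]

theorem expect_smCE_le {D : Dist T} {A : Forecaster T} (hA : IsCondMean D A)
    (S : Finset (Fin T)) :
    expect D (fun x => smCE (fun i : S => x i) (fun i : S => A.predict x i)) ≤
      16 * expect D (fun x => gauge (∑ n ∈ range T, predVar A x n)) := by
  set G := expect D (fun x => gauge (∑ n ∈ range T, predVar A x n)) with hG
  have key : ∀ N : ℕ, 0 < N →
      expect D (fun x => smCE (fun i : S => x i) (fun i : S => A.predict x i)) ≤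
        16 * G + #S * (1 / N) := by
    intro N hN
    have hN' : (0 : ℝ) < N := Nat.cast_pos.2 hN
    refine (expect_mono D fun x => smCE_le_average _ _ hN).trans ?_
    rw [expect_add, expect_add, expect_const, expect_const_mul, expect_sum, Fintype.card_coe]
    -- All predictions are at least `0`, so the threshold `0` gives the bias itself.
    have h0 := expect_abs_threshold_le hA S 0
    simp only [unitInterval.nonneg, if_true, one_mul] at h0
    have h1 := sum_le_card_nsmul (range N) _ _ fun j _ =>
      expect_abs_threshold_le hA S (((j + 1 : ℕ) : ℝ) / N)
    rw [card_range, nsmul_eq_mul] at h1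
    have h2 := mul_le_mul_of_nonneg_left h1 (one_div_nonneg.2 hN'.le)
    rw [one_div, inv_mul_cancel_left₀ hN'.ne'] at h2
    rw [one_div]
    linarith
  refine ge_of_tendsto' (f := fun N : ℕ => 16 * G + #S * (1 / ((N : ℝ) + 1))) (x := Filter.atTop)
    ?_ fun N => ?_
  · simpa using (tendsto_one_div_add_atTop_nhds_zero_nat (𝕜 := ℝ)).const_mul (#S : ℝ)
      |>.const_add (16 * G)
  · simpa using key (N + 1) N.succ_pos

theorem expect_penalty_le {D : Dist T} {A : Forecaster T} (hA : IsCondMean D A) :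
    err SSCE D A ≤ 16 * expect D (fun x => gauge (∑ n ∈ range T, predVar A x n)) := by
  have h := sum_le_card_nsmul univ _ _ fun S (_ : S ∈ univ) => expect_smCE_le hA S
  rw [← expect_sum, card_univ, Fintype.card_finset, Fintype.card_fin, nsmul_eq_mul] at h
  have h2 : err SSCE D A = 1 / 2 ^ T * expect D (fun x => ∑ S : Finset (Fin T),
      smCE (fun i : S => x i) (fun i : S => A.predict x i)) := by
    rw [← expect_const_mul]
    simp only [err, SSCE, one_div_mul_eq_div]
  rw [h2, one_div_mul_eq_div, div_le_iff₀ (by positivity)]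
  push_cast at h
  linarith

/-- With `G` the expected gauge of the predictable variance, the truthful forecaster has error at
most `16 * G`, and every forecaster has error at least `5 / 18 * (2 / 9 * G)`; the quotient of the
constants is `259.2`. -/
theorem isTruthful_SSCE : IsTruthful SSCE 260 0 := by
  intro T D
  have hA := isCondMean_truthful D
  suffices h : err SSCE D (truthful D) / 260 ≤ OPT SSCE D by linarith
  have : Nonempty (Forecaster T) := ⟨truthful D⟩
  refine le_ciInf fun B => ?_
  have h1 := expect_penalty_le hA
  have h2 := expect_gauge_le_expect_sqrt hA B
  have h3 : 5 / 18 * expect D (fun x => √(∑ n ∈ range T, (outcome x n - forecast B x n) ^ 2)) ≤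
      err SSCE D B := by
    rw [← expect_const_mul]
    refine expect_mono D fun x => ?_
    rw [sum_range]
    simpa [outcome, forecast] using sqrt_le_penalty x (B.predict x)
  have h4 : 0 ≤ err SSCE D B := sum_nonneg fun x _ =>
    mul_nonneg (D.2.1 x) (SSCE.penalty_nonneg _ _ _)
  linarith

theorem isComplete_SSCE : IsComplete SSCE := by
  refine ⟨fun T x => ?_, fun α => ?_⟩
  · simp only [SSCE]
    rw [sum_eq_zero fun S _ => ?_, zero_div]
    exact le_antisymm (smCE_le _ _ fun f _ => by simp) (smCE_nonneg _ _)
  · have hle : ∀ T : ℕ, expect (iidBernoulli T α) (fun x => SSCE.penalty T x fun _ => α) ≤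
        16 * √T := fun T => by
      refine (expect_penalty_le (isCondMean_iidBernoulli (T := T) α)).trans ?_
      rw [← expect_const (iidBernoulli T α) (16 * √T), ← expect_const_mul]
      refine expect_mono _ fun x => ?_
      have hV : ∑ n ∈ range T, predVar (fun _ _ => α) x n ≤ T := by
        simpa using sum_le_card_nsmul (range T) _ _ fun n _ => predVar_le_one (fun _ _ => α) x n
      have := gauge_le_sqrt (sum_nonneg fun n (_ : n ∈ range T) =>
        predVar_nonneg (fun _ _ => α) x n)
      have := Real.sqrt_le_sqrt hV
      linarith
    have h0 : ∀ T : ℕ, 0 ≤ expect (iidBernoulli T α) (fun x => SSCE.penalty T x fun _ => α) :=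
      fun T => sum_nonneg fun x _ =>
        mul_nonneg ((iidBernoulli T α).2.1 x) (SSCE.penalty_nonneg _ _ _)
    refine Asymptotics.IsBigO.trans_isLittleO (g := fun T : ℕ => √(T : ℝ))
      (Asymptotics.IsBigO.of_bound 16 (Filter.Eventually.of_forall fun T => ?_)) ?_
    · rw [Real.norm_of_nonneg (h0 T), Real.norm_of_nonneg (Real.sqrt_nonneg _)]
      exact hle T
    · refine Asymptotics.isLittleO_of_tendsto (fun T hT => by rw [hT, Real.sqrt_zero]) ?_
      simp only [Real.sqrt_div_self]
      exact (tendsto_inv_atTop_zero.comp Real.tendsto_sqrt_atTop).comp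
        tendsto_natCast_atTop_atTop

theorem isSound_SSCE : IsSound SSCE := by
  refine ⟨⟨1 / 4, by norm_num, fun T x => ?_⟩, fun α β hαβ =>
    ⟨|(α : ℝ) - β| / 2, half_pos (abs_pos.2 (sub_ne_zero.2 fun h => hαβ (Subtype.ext h))),
      fun T => ?_⟩⟩
  · simp only [SSCE]
    rw [le_div_iff₀ (by positivity)]
    -- This function takes the values `1 / 2` and `-1 / 2` where the error is `1` and `-1`.
    have hf : (fun z : I => 1 / 2 - (z : ℝ)) ∈ lipFamily := by
      refine ⟨LipschitzWith.of_dist_le_mul fun a b => ?_, fun z => ⟨?_, ?_⟩⟩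
      · rw [NNReal.coe_one, one_mul, Real.dist_eq, Subtype.dist_eq, Real.dist_eq, abs_sub_comm]
        exact le_of_eq (by congr 1; ring)
      · linarith [z.2.2]
      · linarith [z.2.1]
    have h : ∀ S : Finset (Fin T), 1 / 2 * (#S : ℝ) ≤
        smCE (fun i : S => x i) (fun i : S => unitInterval.symm (bit (x i))) := fun S => by
      refine le_trans (le_of_eq ?_) (le_smCE _ _ hf)
      rw [sum_congr rfl fun (i : S) _ => (?_ : _ = (1 / 2 : ℝ))]
      · simp [mul_comm]
      · cases x i <;> norm_num [bit]
    refine le_trans (le_of_eq ?_) (sum_le_sum fun S _ => h S)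
    rw [← mul_sum, sum_card_subsets, Fintype.card_fin]
    ring
  · have hmean : ∀ i : Fin T, expect (iidBernoulli T α) (fun x => (bit (x i) : ℝ) - β) = α - β := by
      intro i
      have h := isCondMean_iidBernoulli (T := T) α i (fun _ => 1) fun _ _ _ => rfl
      simp only [one_mul, outcome, forecast, i.2, dif_pos, Forecaster.predict, Fin.eta] at h
      calc _ = expect (iidBernoulli T α) (fun x => ((bit (x i) : ℝ) - α) + (α - β)) := by
            congr 1; funext x; ring
        _ = α - β := by rw [expect_add, h, expect_const, zero_add]
    have h : ∀ S : Finset (Fin T), #S * |(α : ℝ) - β| ≤ expect (iidBernoulli T α)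
        (fun x => smCE (fun i : S => x i) (fun _ : S => β)) := fun S => by
      calc _ = |expect (iidBernoulli T α) (fun x => ∑ i : S, ((bit (x i) : ℝ) - β))| := by
            rw [expect_sum, sum_congr rfl fun (i : S) _ => hmean i]
            rw [sum_const, card_univ, Fintype.card_coe, nsmul_eq_mul, abs_mul, Nat.abs_cast]
        _ ≤ _ := (abs_expect_le _ _).trans (expect_mono _ fun x => abs_sum_le_smCE _ _)
    have h2 : expect (iidBernoulli T α) (fun x => SSCE.penalty T x fun _ => β) =
        1 / 2 ^ T * ∑ S : Finset (Fin T), expect (iidBernoulli T α)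
          (fun x => smCE (fun i : S => x i) (fun _ : S => β)) := by
      rw [← expect_sum, ← expect_const_mul]
      simp only [SSCE, one_div_mul_eq_div]
    rw [h2, one_div_mul_eq_div, le_div_iff₀ (by positivity)]
    refine le_trans (le_of_eq ?_) (sum_le_sum fun S _ => h S)
    rw [← sum_mul, sum_card_subsets, Fintype.card_fin]
    ring

end SSCE

end SeqPred

theorem theorem1p2 :
    (∃ c : ℝ, 0 < c ∧ SeqPred.IsTruthful SeqPred.SSCE c 0) ∧
      SeqPred.IsComplete SeqPred.SSCE ∧ SeqPred.IsSound SeqPred.SSCE :=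
  ⟨⟨260, by norm_num, SeqPred.isTruthful_SSCE⟩, SeqPred.isComplete_SSCE, SeqPred.isSound_SSCE⟩
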